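/- Work in the untyped $\lambda$-calculus, with terms taken modulo $\alpha$-conversion. Let $c_n = \lambda s z.(s(\cdots(s\,z)\cdots))$ ($n$ occurrences of $s$ in the body) be the $n$-th Church numeral, and let $=_{\beta\eta}$ be the equivalence relation induced by $\beta\eta$-reduction. \emph{Expressions with ellipses} are meta-expressions that may contain meta-variables ranging over $\mathbb{N}$ and holes. They are built from indexed variables $x_i$, applications $(E\,F)$, abstractions $\lambda x_i.E$, holes, and ellipses $$C_1[C_2[\cdots C_m[E]\cdots]],$$ where the pattern $C_k[\,\cdot\,]$ is itself an expression with ellipses, which may use the additional meta-variable $k$ and the hole $[\,\cdot\,]$ (any number of times). The indices $i$ and the numbers of repetitions $m$ are primitive recursive functions of the meta-variables in scope; variables without index are those with a constant index. Filling a hole may capture free variables, and for $m=0$ the ellipsis stands for $E$. For example, the patterns $\lambda x_k.[\,\cdot\,]$, $(Q_k\,[\,\cdot\,])$ and $([\,\cdot\,]\,Q_{m+1-k})$ yield $\lambda x_1\cdots x_m.E$, $(Q_1(Q_2\cdots(Q_m\,E)\cdots))$ and $(E\,Q_1\,Q_2\cdots Q_m)$; ellipses may be nested. An \emph{$n$-ary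 $\lambda$-expression written with ellipses} is such an expression $\mathcal{E}$ whose only free meta-variable is $n$ and in which no hole is left unfilled; for every $n\in\mathbb{N}$ it stands for a $\lambda$-term $\mathcal{E}_n$. \textbf{Proposition.} Let $\mathcal{E}_n$ be an $n$-ary $\lambda$-expression written with ellipses, and suppose that there is a finite set of variables that contains the free variables of $\mathcal{E}_n$ for every $n\in\mathbb{N}$ (for instance, that every $\mathcal{E}_n$ is closed). Then there is a single $\lambda$-term $\widehat{\mathcal{E}}$ such that, for every natural number $n$ (including $n=0$), $$(\widehat{\mathcal{E}}\ c_n) =_{\beta\eta} \mathcal{E}_n .$$ -/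

import Mathlib

namespace ArityGeneric

/-- Untyped lambda terms modulo alpha-conversion, in de Bruijn notation. The variables (names) of the
lambda calculus are the natural numbers: under `d` abstractions, `var i` with `i < d` is bound, and
`var (d + x)` is a free occurrence of the variable `x`. So every element of this type is a lambda
term, and equality is identity modulo alpha-conversion. -/
inductive Term : Type
  | var (i : ℕ) : Term
  | app (P Q : Term) : Term
  | lam (P : Term) : Term

namespace Term

/-- Extend a renaming under one abstraction. -/
def liftRen (r : ℕ → ℕ) : ℕ → ℕ
  | 0 => 0
  | i + 1 => r i + 1

/-- Apply a renaming of the free variables. -/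
def rename : (ℕ → ℕ) → Term → Term
  | r, var i => var (r i)
  | r, app P Q => app (rename r P) (rename r Q)
  | r, lam P => lam (rename (liftRen r) P)

/-- Extend a simultaneous substitution under one abstraction. -/
def liftSub (s : ℕ → Term) : ℕ → Term
  | 0 => var 0
  | i + 1 => rename Nat.succ (s i)

/-- Simultaneous capture-avoiding substitution for the free variables. -/
def subst : (ℕ → Term) → Term → Term
  | s, var i => s i
  | s, app P Q => app (subst s P) (subst s Q)
  | s, lam P => lam (subst (liftSub s) P)

/-- The substitution `0 ↦ Q`, `i + 1 ↦ i`, which contracts `(λ.P) Q`. -/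
def single (Q : Term) : ℕ → Term
  | 0 => Q
  | i + 1 => var i

/-- The set of free variables of a term. -/
def freeVars : Term → Set ℕ
  | var i => {i}
  | app P Q => freeVars P ∪ freeVars Q
  | lam P => {x | x + 1 ∈ freeVars P}

/-- `abs x P` is the abstraction `λx.P` of the variable with name `x`. -/
def abs (x : ℕ) (P : Term) : Term :=
  lam (rename (fun y => if y = x then 0 else y + 1) P)

/-- One-step beta-eta reduction, in any context. -/
inductive Step : Term → Term → Prop
  | beta (P Q : Term) : Step (app (lam P) Q) (subst (single Q) P)
  | eta (P : Term) : Step (lam (app (rename Nat.succ P) (var 0))) P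
  | appLeft {P P' : Term} (Q : Term) : Step P P' → Step (app P Q) (app P' Q)
  | appRight (P : Term) {Q Q' : Term} : Step Q Q' → Step (app P Q) (app P Q')
  | lam {P P' : Term} : Step P P' → Step (lam P) (lam P')

/-- Beta-eta equality: the equivalence relation induced by beta-eta reduction. -/
def BetaEta : Term → Term → Prop := Relation.EqvGen Step

/-- The Church numeral `c_n = λs z. s (⋯ (s z) ⋯)`, with `n` occurrences of `s` in the body. -/
def church (n : ℕ) : Term :=
  lam (lam ((app (var 1))^[n] (var 0)))

end Term

/-- The index expressions in `d` meta-variables (such as `n + 1`, `n - k`, `2 * n`): the primitive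
recursive functions of `d` natural numbers. -/
def Index (d : ℕ) : Type := {f : List.Vector ℕ d → ℕ // Nat.Primrec' f}

/-- The meta-language of ellipses. `Expr d h` is the type of the lambda expressions written with
ellipses, in which `d` meta-variables over the natural numbers and `h` holes may occur.

* `var x i` is the indexed variable `x_i`; the letter `x` is a natural number, and a letter without
  index is written with a constant index. A double index `x_{i,j}` is written as one index, by
  a pairing function.
* `app` is application, and `lam x i E` is the abstraction `λ x_i. E`.
* `ellipsis m C E`, where `C` has one more meta-variable `k` and one more hole than the whole
  expression, stands for `C_1[C_2[ ⋯ C_m[E] ⋯ ]]`: an `m`-fold nesting of the pattern `C_k[ ]`, in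
  which free variables of what is put into the hole are captured by abstractions around the hole.
  For `m = 0` it stands for `E`.
* `hole j` is the `j`-th hole in scope, `0` being the one of the innermost ellipsis around it.

The pattern `λ x_k. [ ]` yields `λ x_1 ⋯ x_m. E`, the pattern `Q_k [ ]` yields the
right-associated `(Q_1 (Q_2 ⋯ (Q_m E) ⋯ ))`, and the pattern `[ ] Q_{m+1-k}` yields
the left-associated `(E Q_1 Q_2 ⋯ Q_m)`. Other ranges of `k` are obtained by shifting the indices. -/
inductive Expr : ℕ → ℕ → Type
  | var {d h : ℕ} (x : ℕ) (i : Index d) : Expr d h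
  | app {d h : ℕ} (E F : Expr d h) : Expr d h
  | lam {d h : ℕ} (x : ℕ) (i : Index d) (E : Expr d h) : Expr d h
  | ellipsis {d h : ℕ} (m : Index d) (C : Expr (d + 1) (h + 1)) (E : Expr d h) : Expr d h
  | hole {d h : ℕ} (j : Fin h) : Expr d h

namespace Expr

/-- The lambda term for which an expression with ellipses stands, when the meta-variables have the
values `v` (the one of the innermost ellipsis first) and the holes are filled with the terms `H`.
The variable `x_i` is the variable with the name `Nat.pair x i` (an injective coding). -/
def eval : {d h : ℕ} → Expr d h → List.Vector ℕ d → (Fin h → Term) → Term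
  | _, _, var x i, v, _ => Term.var (Nat.pair x (i.1 v))
  | _, _, app E F, v, H => Term.app (eval E v H) (eval F v H)
  | _, _, lam x i E, v, H => Term.abs (Nat.pair x (i.1 v)) (eval E v H)
  | _, _, ellipsis m C E, v, H =>
      (List.range' 1 (m.1 v)).foldr
        (fun k T => eval C (k ::ᵥ v) (Fin.cons T H : Fin _ → Term)) (eval E v H)
  | _, _, hole j, _, H => H j

/-- For an `n`-ary expression `E` with ellipses, that is, an expression with the one meta-variable
`n` and without unfilled holes, `E.termAt n` is the lambda term `E_n`. -/
def termAt (E : Expr 1 0) (n : ℕ) : Term :=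
  eval E (n ::ᵥ List.Vector.nil) Fin.elim0

end Expr

end ArityGeneric

/-! Expressions with ellipses have an interpreter inside the λ-calculus, and one term runs it on
`c_n`. By structural recursion (`exists_eval`), each expression compiles to a closed term that takes
the encoded meta-variables, the encoded hole fillings and an environment `ρ` sending the numeral of
a name to a term.

A filling is passed as a function of the environment, not as a term. Abstraction `λx_i` evaluates
its body in the environment updated at `x_i` by the freshly bound variable, so a filling read in
that environment has its free `x_i` captured, as required.

Indices are computable since primitive recursive functions are λ-definable on Church numerals
(`exists_primrec`), which also gives the equality test behind `exists_update`. An ellipsis is an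
iteration driven by the numeral of `m`. Finiteness of the set of free variables provides one
environment that returns each of them as itself (`exists_environment`). All the equations come from
β; η is never needed. -/

namespace ArityGeneric

/-! ### Renaming and substitution calculus -/

namespace Term

theorem liftRen_comp (r r' : ℕ → ℕ) : liftRen r ∘ liftRen r' = liftRen (r ∘ r') := by
  funext i; cases i <;> rfl

theorem rename_rename (t : Term) : ∀ r r' : ℕ → ℕ, rename r (rename r' t) = rename (r ∘ r') t := by
  induction t with
  | var i => intro r r'; rfl
  | app P Q hP hQ => intro r r'; simp only [rename, hP, hQ]
  | lam P hP => intro r r'; simp only [rename, hP, liftRen_comp]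

theorem rename_liftRen_succ (r : ℕ → ℕ) (t : Term) :
    rename (liftRen r) (rename Nat.succ t) = rename Nat.succ (rename r t) := by
  rw [rename_rename, rename_rename]; rfl

theorem liftSub_comp_liftRen (s : ℕ → Term) (r : ℕ → ℕ) :
    liftSub s ∘ liftRen r = liftSub (s ∘ r) := by
  funext i; cases i <;> rfl

theorem subst_rename (t : Term) :
    ∀ (s : ℕ → Term) (r : ℕ → ℕ), subst s (rename r t) = subst (s ∘ r) t := by
  induction t with
  | var i => intro s r; rfl
  | app P Q hP hQ => intro s r; simp only [rename, subst, hP, hQ]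
  | lam P hP => intro s r; simp only [rename, subst, hP, liftSub_comp_liftRen]

theorem rename_liftRen_comp_liftSub (r : ℕ → ℕ) (s : ℕ → Term) :
    rename (liftRen r) ∘ liftSub s = liftSub (rename r ∘ s) := by
  funext i
  cases i with
  | zero => rfl
  | succ i => exact rename_liftRen_succ r (s i)

theorem rename_subst (t : Term) :
    ∀ (r : ℕ → ℕ) (s : ℕ → Term), rename r (subst s t) = subst (rename r ∘ s) t := by
  induction t with
  | var i => intro r s; rfl
  | app P Q hP hQ => intro r s; simp only [rename, subst, hP, hQ]
  | lam P hP => intro r s; simp only [rename, subst, hP, rename_liftRen_comp_liftSub]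

theorem liftSub_var : liftSub var = var := by
  funext i; cases i <;> rfl

@[simp]
theorem subst_var (t : Term) : subst var t = t := by
  induction t with
  | var i => rfl
  | app P Q hP hQ => simp only [subst, hP, hQ]
  | lam P hP => simp only [subst, liftSub_var, hP]

theorem subst_congr (t : Term) : ∀ s s' : ℕ → Term, (∀ i ∈ t.freeVars, s i = s' i) →
    subst s t = subst s' t := by
  induction t with
  | var i => intro s s' h; exact h i rfl
  | app P Q hP hQ =>
    intro s s' h
    simp only [subst, hP s s' fun i hi => h i (Or.inl hi), hQ s s' fun i hi => h i (Or.inr hi)]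
  | lam P hP =>
    intro s s' h
    simp only [subst]
    rw [hP (liftSub s) (liftSub s')]
    intro i hi
    cases i with
    | zero => rfl
    | succ i => simp only [liftSub, h i hi]

@[simp]
theorem subst_liftSub_rename_succ (s : ℕ → Term) (t : Term) :
    subst (liftSub s) (rename Nat.succ t) = rename Nat.succ (subst s t) := by
  rw [subst_rename, rename_subst]; rfl

@[simp]
theorem subst_single_rename_succ (Q t : Term) : subst (single Q) (rename Nat.succ t) = t := by
  rw [subst_rename]; exact subst_var t

theorem rename_subst_single (r : ℕ → ℕ) (P Q : Term) :
    rename r (subst (single Q) P) = subst (single (rename r Q)) (rename (liftRen r) P) := by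
  rw [rename_subst, subst_rename]
  congr 1
  funext i; cases i <;> rfl

/-- Syntactic counterpart of the environment update by which the interpreter treats abstraction. -/
theorem subst_abs (s : ℕ → Term) (x : ℕ) (P : Term) :
    subst s (abs x P) = lam (subst (Function.update (rename Nat.succ ∘ s) x (var 0)) P) := by
  simp only [abs, subst, subst_rename]
  congr 2
  funext y
  by_cases h : y = x <;> simp [h, liftSub]

theorem Step.rename {P Q : Term} (h : Step P Q) : ∀ r : ℕ → ℕ, Step (P.rename r) (Q.rename r) := by
  induction h with
  | beta P Q => intro r; rw [rename_subst_single]; exact Step.beta _ _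
  | eta P =>
    intro r
    simp only [Term.rename, rename_liftRen_succ]
    exact Step.eta _
  | appLeft Q _ ih => intro r; exact Step.appLeft _ (ih r)
  | appRight P _ ih => intro r; exact Step.appRight _ (ih r)
  | lam _ ih => intro r; exact Step.lam (ih _)

/-- A term that is invariant under all substitutions. -/
def IsClosed (t : Term) : Prop := ∀ s, subst s t = t

theorem IsClosed.app {P Q : Term} (hP : P.IsClosed) (hQ : Q.IsClosed) : (app P Q).IsClosed :=
  fun s => by simp only [subst, hP s, hQ s]

theorem IsClosed.rename {P : Term} (hP : P.IsClosed) (r : ℕ → ℕ) : P.rename r = P := by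
  have h := rename_subst P r var
  rw [subst_var] at h
  rw [h, hP]

theorem subst_iterate_app (s : ℕ → Term) (F X : Term) (n : ℕ) :
    subst s ((app F)^[n] X) = (app (subst s F))^[n] (subst s X) := by
  induction n with
  | zero => rfl
  | succ n ih => simp only [Function.iterate_succ_apply', subst, ih]

theorem isClosed_church (n : ℕ) : (church n).IsClosed := fun s => by
  simp only [church, subst, subst_iterate_app]
  rfl

@[simp]
theorem subst_church (s : ℕ → Term) (n : ℕ) : subst s (church n) = church n := isClosed_church n s

/-- The combinator `λ a b s. s a b`. -/
def pair : Term := lam (lam (lam (app (app (var 0) (var 2)) (var 1))))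

/-- The first projection `λ p. p (λ a b. a)`. -/
def fst : Term := lam (app (var 0) (lam (lam (var 1))))

/-- The second projection `λ p. p (λ a b. b)`. -/
def snd : Term := lam (app (var 0) (lam (lam (var 0))))

/-- The successor `λ n s z. s (n s z)` of Church numerals. -/
def succ : Term := lam (lam (lam (app (var 1) (app (app (var 2) (var 1)) (var 0)))))

@[simp]
theorem subst_pair (s : ℕ → Term) : subst s pair = pair := rfl

@[simp]
theorem subst_fst (s : ℕ → Term) : subst s fst = fst := rfl

@[simp]
theorem subst_snd (s : ℕ → Term) : subst s snd = snd := rfl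

@[simp]
theorem subst_succ (s : ℕ → Term) : subst s succ = succ := rfl

end Term

/-! ### Terms modulo βη, Church numerals and pairs -/

open Term

/-- Lambda terms modulo beta-eta equality. -/
def Value : Type := Quot Step

namespace Value

/-- The class of a lambda term. -/
def mk (t : Term) : Value := Quot.mk Step t

/-- Application of classes of lambda terms. -/
def app : Value → Value → Value :=
  Quot.map₂ Term.app (fun P _ _ h => Step.appRight P h) (fun _ _ Q h => Step.appLeft Q h)

/-- Application of classes of lambda terms. -/
infixl:80 " ⬝ " => app

/-- Weakening: all free variables are shifted by one. -/
def shift : Value → Value := Quot.map (rename Nat.succ) fun _ _ h => h.rename _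

@[elab_as_elim]
theorem ind {p : Value → Prop} (h : ∀ t, p (mk t)) (x : Value) : p x := Quot.ind h x

theorem mk_eq_mk {P Q : Term} : mk P = mk Q → BetaEta P Q := Quot.eqvGen_exact

@[simp]
theorem mk_app (P Q : Term) : mk (Term.app P Q) = mk P ⬝ mk Q := rfl

@[simp]
theorem shift_mk (P : Term) : shift (mk P) = mk (rename Nat.succ P) := rfl

theorem shift_app (x y : Value) : shift (x ⬝ y) = shift x ⬝ shift y := by
  induction x using Value.ind
  induction y using Value.ind
  rfl

@[simp]
theorem beta (P Q : Term) : mk (lam P) ⬝ mk Q = mk (subst (single Q) P) :=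
  Quot.sound (Step.beta P Q)

theorem mk_lam_congr {P Q : Term} (h : mk P = mk Q) : mk (lam P) = mk (lam Q) :=
  congrArg (Quot.map lam fun _ _ h => Step.lam h) h

/-- The classes of closed terms. -/
def IsClosed (x : Value) : Prop := ∃ t : Term, t.IsClosed ∧ mk t = x

theorem IsClosed.app {x y : Value} (hx : x.IsClosed) (hy : y.IsClosed) : (x ⬝ y).IsClosed := by
  obtain ⟨t, ht, rfl⟩ := hx
  obtain ⟨u, hu, rfl⟩ := hy
  exact ⟨_, ht.app hu, rfl⟩

/-- Lets compiled code and encoded data pass under a binder unchanged. -/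
theorem IsClosed.shift {x : Value} (hx : x.IsClosed) : x.shift = x := by
  obtain ⟨t, ht, rfl⟩ := hx
  rw [shift_mk, ht.rename]

/-- The class of a Church numeral. -/
def num (n : ℕ) : Value := mk (church n)

theorem isClosed_num (n : ℕ) : (num n).IsClosed := ⟨_, isClosed_church n, rfl⟩

theorem num_app_app (n : ℕ) (f x : Value) : num n ⬝ f ⬝ x = (app f)^[n] x := by
  induction f using Value.ind
  induction x using Value.ind
  simp only [num, church, beta, subst, subst_iterate_app, liftSub, single,
    subst_single_rename_succ]
  induction n with
  | zero => rfl
  | succ n ih => rw [Function.iterate_succ_apply', Function.iterate_succ_apply', mk_app, ih]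


/-- The class of the pairing combinator. -/
def pair : Value := mk Term.pair

/-- The class of the first projection. -/
def fst : Value := mk Term.fst

/-- The class of the second projection. -/
def snd : Value := mk Term.snd

/-- The class of the successor combinator. -/
def succ : Value := mk Term.succ

theorem isClosed_pair : pair.IsClosed := ⟨_, subst_pair, rfl⟩

theorem isClosed_fst : fst.IsClosed := ⟨_, subst_fst, rfl⟩

theorem isClosed_snd : snd.IsClosed := ⟨_, subst_snd, rfl⟩

@[simp]
theorem fst_pair (x y : Value) : fst ⬝ (pair ⬝ x ⬝ y) = x := by
  induction x using Value.ind
  induction y using Value.ind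
  simp [fst, pair, Term.fst, Term.pair, subst, liftSub, single, rename]

@[simp]
theorem snd_pair (x y : Value) : snd ⬝ (pair ⬝ x ⬝ y) = y := by
  induction x using Value.ind
  induction y using Value.ind
  simp [snd, pair, Term.snd, Term.pair, subst, liftSub, single, rename]

@[simp]
theorem succ_num (n : ℕ) : succ ⬝ num n = num (n + 1) := by
  simp only [succ, num, Term.succ, beta, subst, liftSub, single]
  rw [(isClosed_church n).rename, (isClosed_church n).rename]
  refine mk_lam_congr (mk_lam_congr ?_)
  rw [Function.iterate_succ_apply', mk_app, mk_app, mk_app, mk_app]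
  congr 1
  refine (num_app_app n _ _).trans ?_
  induction n with
  | zero => rfl
  | succ n ih => rw [Function.iterate_succ_apply', Function.iterate_succ_apply', mk_app, ih]; rfl

/-! ### Combinators and λ-definability of primitive recursive functions -/

theorem exists_const : ∃ c : Value, c.IsClosed ∧ ∀ x y, c ⬝ x ⬝ y = x := by
  refine ⟨_, ⟨lam (lam (var 1)), fun s => rfl, rfl⟩, fun x y => ?_⟩
  induction x using Value.ind
  induction y using Value.ind
  simp [subst, liftSub, single]

theorem exists_comp : ∃ c : Value, c.IsClosed ∧ ∀ f g x, c ⬝ f ⬝ g ⬝ x = f ⬝ (g ⬝ x) := by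
  refine ⟨_, ⟨lam (lam (lam (.app (var 2) (.app (var 1) (var 0))))), fun s => rfl, rfl⟩,
    fun f g x => ?_⟩
  induction f using Value.ind
  induction g using Value.ind
  induction x using Value.ind
  simp [subst, liftSub, single, rename]

theorem exists_pairing : ∃ c : Value, c.IsClosed ∧
    ∀ f g x, c ⬝ f ⬝ g ⬝ x = pair ⬝ (f ⬝ x) ⬝ (g ⬝ x) := by
  refine ⟨_, ⟨lam (lam (lam (.app (.app Term.pair (.app (var 2) (var 0)))
    (.app (var 1) (var 0))))), fun s => rfl, rfl⟩, fun f g x => ?_⟩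
  induction f using Value.ind
  induction g using Value.ind
  induction x using Value.ind
  simp [pair, subst, liftSub, single, rename]

/-- Church numerals only iterate, so the state `s` pairs the recursion counter with the current
value; `t` holds the parameters. -/
theorem exists_precStep : ∃ c : Value, c.IsClosed ∧ ∀ g t s, c ⬝ g ⬝ t ⬝ s =
    pair ⬝ (succ ⬝ (fst ⬝ s)) ⬝ (g ⬝ (pair ⬝ (fst ⬝ s) ⬝ (pair ⬝ (snd ⬝ s) ⬝ t))) := by
  refine ⟨_, ⟨lam (lam (lam (.app (.app Term.pair (.app Term.succ (.app Term.fst (var 0))))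
    (.app (var 2) (.app (.app Term.pair (.app Term.fst (var 0)))
      (.app (.app Term.pair (.app Term.snd (var 0))) (var 1))))))), fun s => rfl, rfl⟩,
    fun g t s => ?_⟩
  induction g using Value.ind
  induction t using Value.ind
  induction s using Value.ind
  simp [pair, fst, snd, succ, subst, liftSub, single, rename]

theorem exists_prec : ∃ c : Value, c.IsClosed ∧ ∀ f p v, c ⬝ f ⬝ p ⬝ v =
    snd ⬝ (fst ⬝ v ⬝ (p ⬝ (snd ⬝ v)) ⬝ (pair ⬝ num 0 ⬝ (f ⬝ (snd ⬝ v)))) := by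
  refine ⟨_, ⟨lam (lam (lam (.app Term.snd (.app
    (.app (.app Term.fst (var 0)) (.app (var 1) (.app Term.snd (var 0))))
    (.app (.app Term.pair (church 0)) (.app (var 2) (.app Term.snd (var 0)))))))),
    fun s => rfl, rfl⟩, fun f p v => ?_⟩
  induction f using Value.ind
  induction p using Value.ind
  induction v using Value.ind
  simp [pair, fst, snd, num, subst, liftSub, single, rename]

/-- The value that encodes a tuple by iterated pairing. -/
def tuple : {n : ℕ} → (Fin n → Value) → Value
  | 0, _ => num 0
  | _ + 1, f => pair ⬝ f 0 ⬝ tuple fun i => f i.succ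

theorem isClosed_tuple : ∀ {n : ℕ} {f : Fin n → Value}, (∀ i, (f i).IsClosed) → (tuple f).IsClosed
  | 0, _, _ => isClosed_num 0
  | _ + 1, _, h => (isClosed_pair.app (h 0)).app (isClosed_tuple fun i => h i.succ)

theorem exists_comp_closed {f g : Value} (hf : f.IsClosed) (hg : g.IsClosed) :
    ∃ c : Value, c.IsClosed ∧ ∀ x, c ⬝ x = f ⬝ (g ⬝ x) := by
  obtain ⟨b, hb, h⟩ := exists_comp
  exact ⟨_, (hb.app hf).app hg, h f g⟩

theorem exists_proj : ∀ {n : ℕ} (i : Fin n), ∃ c : Value, c.IsClosed ∧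
    ∀ f : Fin n → Value, c ⬝ tuple f = f i
  | n + 1, i => by
    cases i using Fin.cases with
    | zero => exact ⟨fst, isClosed_fst, fun f => fst_pair _ _⟩
    | succ i =>
      obtain ⟨p, hp, h⟩ := exists_proj i
      obtain ⟨c, hc, hcp⟩ := exists_comp_closed hp isClosed_snd
      exact ⟨c, hc, fun f => by rw [hcp, tuple, snd_pair, h]⟩

theorem exists_tupling : ∀ {n : ℕ} {g : Fin n → Value}, (∀ i, (g i).IsClosed) →
    ∃ c : Value, c.IsClosed ∧ ∀ x, c ⬝ x = tuple fun i => g i ⬝ x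
  | 0, _, _ => by
    obtain ⟨k, hk, h⟩ := exists_const
    exact ⟨_, hk.app (isClosed_num 0), h _⟩
  | n + 1, g, hg => by
    obtain ⟨t, ht, h⟩ := exists_tupling fun i => hg i.succ
    obtain ⟨c, hc, hcp⟩ := exists_pairing
    exact ⟨_, (hc.app (hg 0)).app ht, fun x => by rw [hcp, h, tuple]⟩

/-- The value that encodes a vector of natural numbers. -/
def vec {n : ℕ} (v : List.Vector ℕ n) : Value := tuple fun i => num (v.get i)

theorem isClosed_vec {n : ℕ} (v : List.Vector ℕ n) : (vec v).IsClosed :=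
  isClosed_tuple fun _ => isClosed_num _

theorem vec_cons {n : ℕ} (a : ℕ) (v : List.Vector ℕ n) :
    vec (a ::ᵥ v) = pair ⬝ num a ⬝ vec v := by
  simp [vec, tuple]

theorem exists_primrec {n : ℕ} {f : List.Vector ℕ n → ℕ} (hf : Nat.Primrec' f) :
    ∃ c : Value, c.IsClosed ∧ ∀ v, c ⬝ vec v = num (f v) := by
  induction hf with
  | zero =>
    obtain ⟨k, hk, h⟩ := exists_const
    exact ⟨_, hk.app (isClosed_num 0), fun v => h _ _⟩
  | succ =>
    obtain ⟨c, hc, h⟩ := exists_comp_closed (f := succ) ⟨_, subst_succ, rfl⟩ isClosed_fst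
    refine ⟨c, hc, fun v => ?_⟩
    rw [h, vec, tuple, fst_pair, succ_num, List.Vector.get_zero]
  | get i =>
    obtain ⟨c, hc, h⟩ := exists_proj i
    exact ⟨c, hc, fun v => h _⟩
  | comp g _ _ hf hg =>
    obtain ⟨f', hf', h⟩ := hf
    choose g' hg' hgv using hg
    obtain ⟨t, ht, htv⟩ := exists_tupling hg'
    obtain ⟨c, hc, hcv⟩ := exists_comp_closed hf' ht
    refine ⟨c, hc, fun v => ?_⟩
    simp only [hcv, htv, ← h, hgv]
    simp [vec]
  | @prec n f g _ _ hf hg =>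
    obtain ⟨f', hf', hfv⟩ := hf
    obtain ⟨g', hg', hgv⟩ := hg
    obtain ⟨p, hp, hpv⟩ := exists_precStep
    obtain ⟨c, hc, hcv⟩ := exists_prec
    refine ⟨_, (hc.app hf').app (hp.app hg'), fun v => ?_⟩
    obtain ⟨a, v, rfl⟩ := v.exists_eq_cons
    rw [hcv, vec_cons, fst_pair, snd_pair, num_app_app, hfv]
    -- Loop invariant: after `a` steps the state is the counter `a` with the recursion's value at
    -- `a`.
    have key : ∀ a : ℕ, (app (p ⬝ g' ⬝ vec v))^[a] (pair ⬝ num 0 ⬝ num (f v)) =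
        pair ⬝ num a ⬝ num (Nat.rec (f v) (fun y IH => g (y ::ᵥ IH ::ᵥ v)) a) := by
      intro a
      induction a with
      | zero => rfl
      | succ a ih =>
        rw [Function.iterate_succ_apply', ih, hpv]
        simp only [fst_pair, snd_pair, succ_num, ← vec_cons, hgv]
    rw [key, snd_pair]
    simp only [List.Vector.head_cons, List.Vector.tail_cons]

/-- The value `x` yields, for every environment `ρ` that lists a substitution `σ`, the instance of
the term `T` under `σ`. -/
structure Represents (x : Value) (T : Term) : Prop where
  isClosed : x.IsClosed
  app_eq : ∀ (ρ : Value) (σ : ℕ → Term), (∀ n, ρ ⬝ num n = mk (σ n)) → x ⬝ ρ = mk (subst σ T)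

/-! ### Environments -/

/-- With `d` a distance and `k` the constant combinator, the constant map to `ρ ⬝ i` is iterated on
`y`: zero times gives `y`, any positive number of times gives `ρ ⬝ i`. -/
theorem exists_update_of_dist : ∃ c : Value, c.IsClosed ∧ ∀ k d a ρ y i, c ⬝ k ⬝ d ⬝ a ⬝ ρ ⬝ y ⬝ i =
    d ⬝ (pair ⬝ a ⬝ (pair ⬝ i ⬝ num 0)) ⬝ (k ⬝ (ρ ⬝ i)) ⬝ y := by
  refine ⟨_, ⟨lam (lam (lam (lam (lam (lam (.app (.app (.app (var 4)
    (.app (.app Term.pair (var 3)) (.app (.app Term.pair (var 0)) (church 0))))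
    (.app (var 5) (.app (var 2) (var 0)))) (var 1))))))), fun s => rfl, rfl⟩,
    fun k d a ρ y i => ?_⟩
  induction k using Value.ind
  induction d using Value.ind
  induction a using Value.ind
  induction ρ using Value.ind
  induction y using Value.ind
  induction i using Value.ind
  simp [pair, num, subst, liftSub, single, rename]

/-- Environments, as functions on Church numerals, can be updated by a combinator. -/
theorem exists_update : ∃ c : Value, c.IsClosed ∧ ∀ a ρ y i,
    c ⬝ num a ⬝ ρ ⬝ y ⬝ num i = if i = a then y else ρ ⬝ num i := by
  obtain ⟨d, hd, hdv⟩ := exists_primrec (n := 2)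
    -- Truncated subtraction in both directions: the sum vanishes exactly when the two entries
    -- agree.
    (f := fun v => (v.head - v.tail.head) + (v.tail.head - v.head))
    (.comp₂ (· + ·) .add .sub (.comp₂ (· - ·) .sub (.tail .head) .head))
  obtain ⟨k, hk, hkv⟩ := exists_const
  obtain ⟨c, hc, hcv⟩ := exists_update_of_dist
  refine ⟨_, (hc.app hk).app hd, fun a ρ y i => ?_⟩
  have h := hdv (a ::ᵥ i ::ᵥ List.Vector.nil)
  simp only [vec_cons, List.Vector.head_cons, List.Vector.tail_cons] at h
  rw [hcv, show num 0 = vec List.Vector.nil from rfl, h, num_app_app]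
  split_ifs with hi
  · simp [hi]
  · obtain ⟨m, hm⟩ := Nat.exists_eq_succ_of_ne_zero (show (a - i) + (i - a) ≠ 0 by omega)
    rw [hm, Function.iterate_succ_apply', hkv]

/-! ### The interpreter, clause by clause -/

theorem exists_evalVar : ∃ c : Value, c.IsClosed ∧ ∀ n v h ρ,
    c ⬝ n ⬝ v ⬝ h ⬝ ρ = ρ ⬝ (n ⬝ v) := by
  refine ⟨_, ⟨lam (lam (lam (lam (.app (var 0) (.app (var 3) (var 2)))))), fun s => rfl, rfl⟩,
    fun n v h ρ => ?_⟩
  induction n using Value.ind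
  induction v using Value.ind
  induction h using Value.ind
  induction ρ using Value.ind
  simp [subst, liftSub, single, rename]

theorem exists_evalApp : ∃ c : Value, c.IsClosed ∧ ∀ e f v h ρ,
    c ⬝ e ⬝ f ⬝ v ⬝ h ⬝ ρ = (e ⬝ v ⬝ h ⬝ ρ) ⬝ (f ⬝ v ⬝ h ⬝ ρ) := by
  refine ⟨_, ⟨lam (lam (lam (lam (lam (.app
    (.app (.app (.app (var 4) (var 2)) (var 1)) (var 0))
    (.app (.app (.app (var 3) (var 2)) (var 1)) (var 0))))))), fun s => rfl, rfl⟩,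
    fun e f v h ρ => ?_⟩
  induction e using Value.ind
  induction f using Value.ind
  induction v using Value.ind
  induction h using Value.ind
  induction ρ using Value.ind
  simp [subst, liftSub, single, rename]

/-- The body is evaluated under the new binder: everything from outside is shifted, and `var 0` is
the value bound to the name. -/
theorem exists_evalLam : ∃ c : Value, c.IsClosed ∧ ∀ u e n v h ρ B,
    e.shift ⬝ v.shift ⬝ h.shift ⬝ (u.shift ⬝ (n.shift ⬝ v.shift) ⬝ ρ.shift ⬝ mk (var 0)) = mk B →
    c ⬝ u ⬝ e ⬝ n ⬝ v ⬝ h ⬝ ρ = mk (lam B) := by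
  refine ⟨_, ⟨lam (lam (lam (lam (lam (lam (lam (.app
    (.app (.app (var 5) (var 3)) (var 2))
    (.app (.app (.app (var 6) (.app (var 4) (var 3))) (var 1)) (var 0))))))))),
    fun s => rfl, rfl⟩, fun u e n v h ρ B hB => ?_⟩
  induction u using Value.ind
  induction e using Value.ind
  induction n using Value.ind
  induction v using Value.ind
  induction h using Value.ind
  induction ρ using Value.ind
  simp only [beta, subst, liftSub, single, rename, subst_liftSub_rename_succ,
    subst_single_rename_succ]
  exact mk_lam_congr hB

/-- The state pairs `k` with the value of the part already built. The counter runs down from `m`,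
because `C_m` is the innermost pattern. -/
theorem exists_evalEllipsisStep : ∃ c : Value, c.IsClosed ∧ ∀ p e v h s,
    c ⬝ p ⬝ e ⬝ v ⬝ h ⬝ s = pair ⬝ (p ⬝ (pair ⬝ (fst ⬝ s) ⬝ num 0)) ⬝
      (e ⬝ (pair ⬝ (fst ⬝ s) ⬝ v) ⬝ (pair ⬝ (snd ⬝ s) ⬝ h)) := by
  refine ⟨_, ⟨lam (lam (lam (lam (lam (.app
    (.app Term.pair (.app (var 4) (.app (.app Term.pair (.app Term.fst (var 0))) (church 0))))
    (.app (.app (var 3) (.app (.app Term.pair (.app Term.fst (var 0))) (var 2)))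
      (.app (.app Term.pair (.app Term.snd (var 0))) (var 1)))))))), fun s => rfl, rfl⟩,
    fun p e v h s => ?_⟩
  induction p using Value.ind
  induction e using Value.ind
  induction v using Value.ind
  induction h using Value.ind
  induction s using Value.ind
  simp [pair, fst, snd, num, subst, liftSub, single, rename]

theorem exists_evalEllipsis : ∃ c : Value, c.IsClosed ∧ ∀ p m e v h,
    c ⬝ p ⬝ m ⬝ e ⬝ v ⬝ h =
      snd ⬝ ((m ⬝ v) ⬝ (p ⬝ v ⬝ h) ⬝ (pair ⬝ (m ⬝ v) ⬝ (e ⬝ v ⬝ h))) := by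
  refine ⟨_, ⟨lam (lam (lam (lam (lam (.app Term.snd (.app
    (.app (.app (var 3) (var 1)) (.app (.app (var 4) (var 1)) (var 0)))
    (.app (.app Term.pair (.app (var 3) (var 1))) (.app (.app (var 2) (var 1)) (var 0))))))))),
    fun s => rfl, rfl⟩, fun p m e v h => ?_⟩
  induction p using Value.ind
  induction m using Value.ind
  induction e using Value.ind
  induction v using Value.ind
  induction h using Value.ind
  simp [pair, snd, subst, liftSub, single, rename]

theorem exists_evalHole : ∃ c : Value, c.IsClosed ∧ ∀ p v h, c ⬝ p ⬝ v ⬝ h = p ⬝ h := by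
  refine ⟨_, ⟨lam (lam (lam (.app (var 2) (var 0)))), fun s => rfl, rfl⟩, fun p v h => ?_⟩
  induction p using Value.ind
  induction v using Value.ind
  induction h using Value.ind
  simp [subst, liftSub, single]

/-- Both `num 0` encode empty tuples: the end of the one-entry vector `n`, and the absence of holes.
-/
theorem exists_instantiate : ∃ c : Value, ∀ e ρ n,
    c ⬝ e ⬝ ρ ⬝ n = e ⬝ (pair ⬝ n ⬝ num 0) ⬝ num 0 ⬝ ρ := by
  refine ⟨mk (lam (lam (lam (.app (.app (.app (var 2)
    (.app (.app Term.pair (var 0)) (church 0))) (church 0)) (var 1))))), fun e ρ n => ?_⟩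
  induction e using Value.ind
  induction ρ using Value.ind
  induction n using Value.ind
  simp [pair, num, subst, liftSub, single, rename]

/-- Every expression with ellipses has an interpreter: a closed value that represents all its
instances, uniformly in the values of the meta-variables and the fillings of the holes. -/
theorem exists_eval {d h : ℕ} (E : Expr d h) : ∃ c : Value, c.IsClosed ∧
    ∀ (v : List.Vector ℕ d) (H : Fin h → Term) (R : Fin h → Value),
      (∀ j, Represents (R j) (H j)) → Represents (c ⬝ vec v ⬝ tuple R) (E.eval v H) := by
  induction E with
  | var x i =>
    obtain ⟨n, hn, hnv⟩ := exists_primrec (.comp₂ Nat.pair .natPair (.const x) i.2)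
    obtain ⟨c, hc, hcv⟩ := exists_evalVar
    refine ⟨_, hc.app hn, fun v H R hR => ⟨?_, fun ρ σ hρ => ?_⟩⟩
    · exact ((hc.app hn).app (isClosed_vec v)).app (isClosed_tuple fun j => (hR j).isClosed)
    · rw [hcv, hnv, hρ]; rfl
  | app E F hE hF =>
    obtain ⟨e, he, hev⟩ := hE
    obtain ⟨f, hf, hfv⟩ := hF
    obtain ⟨c, hc, hcv⟩ := exists_evalApp
    refine ⟨_, (hc.app he).app hf, fun v H R hR => ⟨?_, fun ρ σ hρ => ?_⟩⟩
    · exact (((hc.app he).app hf).app (isClosed_vec v)).app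
        (isClosed_tuple fun j => (hR j).isClosed)
    · rw [hcv, (hev v H R hR).app_eq ρ σ hρ, (hfv v H R hR).app_eq ρ σ hρ]; rfl
  | lam x i E hE =>
    obtain ⟨n, hn, hnv⟩ := exists_primrec (.comp₂ Nat.pair .natPair (.const x) i.2)
    obtain ⟨e, he, hev⟩ := hE
    obtain ⟨u, hu, huv⟩ := exists_update
    obtain ⟨c, hc, hcv⟩ := exists_evalLam
    have hc' := ((hc.app hu).app he).app hn
    refine ⟨_, hc', fun v H R hR => ?_⟩
    have hv := isClosed_vec v
    have ht : (tuple R).IsClosed := isClosed_tuple fun j => (hR j).isClosed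
    refine ⟨(hc'.app hv).app ht, fun ρ σ hρ => ?_⟩
    rw [Expr.eval, subst_abs]
    apply hcv
    rw [he.shift, hv.shift, ht.shift, hu.shift, hn.shift, hnv]
    refine (hev v H R hR).app_eq _ _ fun k => ?_
    rw [huv, Function.update_apply]
    split_ifs
    · rfl
    -- At other names, shifting the looked-up value equals looking up in the shifted environment, as
    -- numerals are closed.
    · rw [← (isClosed_num k).shift, ← shift_app, hρ]; rfl
  | ellipsis m C E hC hE =>
    obtain ⟨n, hn, hnv⟩ := exists_primrec m.2
    obtain ⟨p, hp, hpv⟩ := exists_primrec .pred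
    obtain ⟨e, he, hev⟩ := hE
    obtain ⟨f, hf, hfv⟩ := hC
    obtain ⟨s, hs, hsv⟩ := exists_evalEllipsisStep
    obtain ⟨c, hc, hcv⟩ := exists_evalEllipsis
    refine ⟨_, ((hc.app ((hs.app hp).app hf)).app hn).app he, fun v H R hR => ?_⟩
    rw [hcv, hnv, num_app_app, Expr.eval]
    have hp' (k : ℕ) : p ⬝ (pair ⬝ num (k + 1) ⬝ num 0) = num k := by
      have := hpv ((k + 1) ::ᵥ List.Vector.nil)
      rwa [vec_cons] at this
    generalize m.1 v = k
    have hb := hev v H R hR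
    generalize e ⬝ vec v ⬝ tuple R = x at hb ⊢
    generalize E.eval v H = b at hb ⊢
    -- One loop step wraps `b` in the innermost remaining pattern, the last entry of the range, so
    -- the accumulated term must vary.
    induction k generalizing x b with
    | zero => simpa using hb
    | succ k ih =>
      rw [Function.iterate_succ_apply, hsv, fst_pair, snd_pair, hp', List.range'_concat,
        List.foldr_append]
      refine ih _ _ ?_
      rw [← vec_cons, one_mul, add_comm 1 k]
      refine hfv ((k + 1) ::ᵥ v) (Fin.cons b H) (Fin.cons x R) fun j => ?_
      cases j using Fin.cases with
      | zero => exact hb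
      | succ j => exact hR j
  | hole j =>
    obtain ⟨p, hp, hpv⟩ := exists_proj j
    obtain ⟨c, hc, hcv⟩ := exists_evalHole
    refine ⟨_, hc.app hp, fun v H R hR => ?_⟩
    rw [hcv, hpv]
    exact hR j

/-- Finitely many updates of a constant environment; values at names outside `S` are irrelevant. -/
theorem exists_environment (S : Finset ℕ) : ∃ (ρ : Value) (σ : ℕ → Term),
    (∀ n, ρ ⬝ num n = mk (σ n)) ∧ ∀ i ∈ S, σ i = var i := by
  induction S using Finset.induction_on with
  | empty =>
    obtain ⟨k, _, hk⟩ := exists_const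
    exact ⟨k ⬝ mk (var 0), fun _ => var 0, fun n => hk _ _, by simp⟩
  | insert a S _ ih =>
    obtain ⟨ρ, σ, hρ, hσ⟩ := ih
    obtain ⟨u, _, hu⟩ := exists_update
    refine ⟨u ⬝ num a ⬝ ρ ⬝ mk (var a), Function.update σ a (var a), fun n => ?_, fun i hi => ?_⟩
    · rw [hu, Function.update_apply, hρ]
      split_ifs <;> rfl
    · rw [Function.update_apply]
      split_ifs with h
      · rw [h]
      · exact hσ i ((Finset.mem_insert.1 hi).resolve_left h)

end Value
end ArityGeneric

open ArityGeneric in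
theorem mainTheorem1 (E : ArityGeneric.Expr 1 0) (S : Finset ℕ)
    (hS : ∀ n : ℕ, (E.termAt n).freeVars ⊆ (S : Set ℕ)) :
    ∃ A : ArityGeneric.Term, ∀ n : ℕ,
      ArityGeneric.Term.BetaEta (ArityGeneric.Term.app A (ArityGeneric.Term.church n)) (E.termAt n) := by
  obtain ⟨e, _, he⟩ := Value.exists_eval E
  obtain ⟨ρ, σ, hρ, hσ⟩ := Value.exists_environment S
  obtain ⟨c, hc⟩ := Value.exists_instantiate
  obtain ⟨A, hA⟩ := Quot.exists_rep ((c.app e).app ρ)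
  refine ⟨A, fun n => Value.mk_eq_mk ?_⟩
  rw [Value.mk_app, show Value.mk A = _ from hA, show Value.mk (Term.church n) = Value.num n from rfl,
    hc]
  have h := (he (n ::ᵥ List.Vector.nil) Fin.elim0 Fin.elim0 fun j => j.elim0).app_eq ρ σ hρ
  rw [Value.vec_cons] at h
  -- `σ` fixes every free variable of `E_n`, so it acts as the identity there.
  refine h.trans (congrArg Value.mk ?_)
  exact (Term.subst_congr _ _ _ fun i hi => hσ i (hS n hi)).trans (Term.subst_var _)
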